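/- Let $\mathfrak{E}=\mathbb{R}\times\mathbb{S}^3$ be the Einstein cylinder with metric $\mathfrak{e}=d\tau^2-\mathfrak{s}_3$, where $\mathfrak{s}_3$ is the round metric of the unit sphere $\mathbb{S}^3$, with Levi-Civita connection $\slashed\nabla$; all norms below are over $(\mathbb{S}^3,\mathfrak{s}_3)$, and a dot denotes $\partial_\tau$. For a real $1$-form $A$ on $\mathfrak{E}$ let $A_0=A(\partial_\tau)$, let $\mathbf{A}$ be the projection of $A$ onto $\mathbb{S}^3$, and set \[ \mathrm{S}_1[A](\tau)=\|\dot{\mathbf{A}}\|_{L^2}^2(\tau)+\|\mathbf{A}\|_{H^1}^2(\tau)+\|A_0\|_{H^1}^2(\tau), \] where $\|u\|_{H^1}^2=\|u\|_{L^2}^2+\|\slashed\nabla u\|_{L^2}^2$. For a complex scalar field $\psi$ on $\mathfrak{E}$ set \[ \mathrm{S}_1[\psi](\tau)=\|\dot\psi\|_{L^2}^2(\tau)+\|\psi\|_{H^1}^2(\tau), \qquad \mathrm{D}_a\psi=\nabla_a\psi+iA_a\psi, \] \[ \mathbf{T}_{ab}[\psi]=\overline{\mathrm{D}_{(a}\psi}\,\mathrm{D}_{b)}\psi-\tfrac12\mathfrak{e}_{ab}\overline{\mathrm{D}_c\psi}\,\mathrm{D}^c\psi+\tfrac12\mathfrak{e}_{ab}|\psi|^2,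 \qquad \mathcal{E}_\tau[\psi]=\int_{\{\tau\}\times\mathbb{S}^3}\mathbf{T}_{ab}[\psi]\,T^aT^b\,\mathrm{dvol}_{\mathfrak{s}_3},\quad T=\partial_\tau, \] so that $\mathcal{E}_\tau[\psi]=\tfrac12\|\mathrm{D}_0\psi\|_{L^2}^2+\tfrac12\|\slashed{\mathrm{D}}\psi\|_{L^2}^2+\tfrac12\|\psi\|_{L^2}^2$ at time $\tau$, where $\mathrm{D}_0\psi=\dot\psi+iA_0\psi$ and $\slashed{\mathrm{D}}\psi=\slashed\nabla\psi+i\mathbf{A}\psi$. \textbf{Theorem.} There exist constants $\epsilon>0$ and $C>0$ such that for every $\tau\in\mathbb{R}$, every real $1$-form $A$ of class $C^1$ on $\mathfrak{E}$ and every complex scalar field $\psi$ of class $C^1$ on $\mathfrak{E}$: if $\mathrm{S}_1[A](\tau)\le\epsilon$, then \[ \mathrm{S}_1[\psi](\tau)\le C\,\mathcal{E}_\tau[\psi]\qquad\text{and}\qquad \mathcal{E}_\tau[\psi]\le C\,\mathrm{S}_1[\psi](\tau). \] -/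

import Mathlib

open scoped Manifold ContDiff InnerProductSpace

noncomputable section

namespace EinsteinCylinder

/-! ### The round 3-sphere -/

/-- The ambient Euclidean space `ℝ⁴`. -/
abbrev E4 : Type := EuclideanSpace ℝ (Fin 4)

instance factFinrankE4 : Fact (Module.finrank ℝ E4 = 3 + 1) :=
  ⟨by simp⟩

/-- The unit sphere `𝕊³ ⊂ ℝ⁴`, with Mathlib's manifold structure. -/
abbrev S3 : Type := Metric.sphere (0 : E4) 1

/-- The standard surface measure of `𝕊³`, i.e. the volume measure of the round metric. -/
def dvol : MeasureTheory.Measure S3 := (MeasureTheory.volume : MeasureTheory.Measure E4).toSphere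

/-- The differential `T_x𝕊³ → ℝ⁴` of the inclusion at `x`. -/
def dIncl (x : S3) : TangentSpace (𝓡 3) x →L[ℝ] E4 :=
  mvfderiv (𝓡 3) ((↑) : S3 → E4) x

/-- The round metric `𝔰₃` (positive definite), induced from `ℝ⁴`. -/
def roundMetric (x : S3) (u v : TangentSpace (𝓡 3) x) : ℝ :=
  ⟪dIncl x u, dIncl x v⟫_ℝ

/-- Orthogonal projection of `w ∈ ℝ⁴` onto `x^⊥`, the image of `T_x𝕊³` in `ℝ⁴`. -/
def tangProj (x : S3) (w : E4) : E4 := w - ⟪(x : E4), w⟫_ℝ • (x : E4)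

theorem exists_dIncl_eq (x : S3) (w : E4) :
    ∃ u : TangentSpace (𝓡 3) x, dIncl x u = tangProj x w := by
  have h : tangProj x w ∈ (dIncl x).range := by
    rw [dIncl, range_mvfderiv_subtypeVal, Submodule.mem_orthogonal_singleton_iff_inner_right]
    have hx : ‖(x : E4)‖ = 1 := by simp
    simp [tangProj, inner_sub_right, inner_smul_right, hx]
  exact h

/-- The vector field `E_j` on `𝕊³` obtained by projecting the `j`-th standard unit vector of `ℝ⁴`
to the tangent spaces. -/
def frame (j : Fin 4) (x : S3) : TangentSpace (𝓡 3) x :=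
  (exists_dIncl_eq x (EuclideanSpace.single j 1)).choose

theorem dIncl_frame (j : Fin 4) (x : S3) :
    dIncl x (frame j x) = tangProj x (EuclideanSpace.single j 1) :=
  (exists_dIncl_eq x (EuclideanSpace.single j 1)).choose_spec

theorem inner_dIncl (x : S3) (u : TangentSpace (𝓡 3) x) : ⟪(x : E4), dIncl x u⟫_ℝ = 0 := by
  have h : dIncl x u ∈ (dIncl x).range := ⟨u, rfl⟩
  rwa [dIncl, range_mvfderiv_subtypeVal, Submodule.mem_orthogonal_singleton_iff_inner_right] at h

/-- The four fields `E_j` are a Parseval frame of `T_x𝕊³` for the round metric: contracting with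
`∑ j, E_j ⊗ E_j` is the same as contracting with an orthonormal basis. -/
theorem sum_roundMetric_frame (x : S3) (u v : TangentSpace (𝓡 3) x) :
    ∑ j : Fin 4, roundMetric x (frame j x) u * roundMetric x (frame j x) v =
      roundMetric x u v := by
  have h : ∀ (j : Fin 4) (w : TangentSpace (𝓡 3) x),
      roundMetric x (frame j x) w = dIncl x w j := by
    intro j w
    rw [roundMetric, dIncl_frame, tangProj, inner_sub_left, inner_smul_left, inner_dIncl]
    simp [EuclideanSpace.inner_single_left]
  simp_rw [h, roundMetric, PiLp.inner_apply]
  simp [mul_comm]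

/-- `|η|²` for a (real, complex or vector valued) covector `η` at `x ∈ 𝕊³`, w.r.t. the round metric. -/
def covecNormSq {F : Type} [Norm F] (x : S3) (η : TangentSpace (𝓡 3) x → F) : ℝ :=
  ∑ j : Fin 4, ‖η (frame j x)‖ ^ 2

/-- The vector field dual to the 1-form `α` on `𝕊³` w.r.t. the round metric, as a map
into `ℝ⁴`: it takes values in `x^⊥ ≅ T_x𝕊³`. -/
def sharp (α : ∀ x : S3, TangentSpace (𝓡 3) x →L[ℝ] ℝ) (x : S3) : E4 :=
  ∑ j : Fin 4, α x (frame j x) • dIncl x (frame j x)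

theorem inner_sharp (α : ∀ x : S3, TangentSpace (𝓡 3) x →L[ℝ] ℝ) (x : S3)
    (u : TangentSpace (𝓡 3) x) : ⟪sharp α x, dIncl x u⟫_ℝ = α x u := by
  have hu : ∑ j : Fin 4, roundMetric x (frame j x) u • frame j x = u := by
    apply injective_mvfderiv_subtypeVal_sphere x
    change dIncl x _ = dIncl x u
    refine ext_inner_right ℝ fun w => ?_
    obtain ⟨w', hw'⟩ := exists_dIncl_eq x w
    have key : ∀ z : TangentSpace (𝓡 3) x, ⟪dIncl x z, w⟫_ℝ = roundMetric x z w' := by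
      intro z
      rw [roundMetric, hw', tangProj, inner_sub_right, inner_smul_right, real_inner_comm (x : E4),
        inner_dIncl, mul_zero, sub_zero]
    rw [key u, ← sum_roundMetric_frame x u w', map_sum, sum_inner]
    refine Finset.sum_congr rfl fun j _ => ?_
    rw [map_smul, inner_smul_left, key]
    simp
  conv_rhs => rw [← hu]
  rw [map_sum, sharp, sum_inner]
  refine Finset.sum_congr rfl fun j _ => ?_
  rw [map_smul, inner_smul_left, smul_eq_mul, mul_comm]
  rfl

/-- The Levi-Civita derivative `∇̸_u α` of a 1-form on `𝕊³` (as a vector tangent to `𝕊³`, identified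
with a covector by the metric): the tangential part of the derivative in `ℝ⁴` (Gauss formula). -/
def covDeriv (α : ∀ x : S3, TangentSpace (𝓡 3) x →L[ℝ] ℝ) (x : S3)
    (u : TangentSpace (𝓡 3) x) : E4 :=
  tangProj x (mvfderiv (𝓡 3) (sharp α) x u)

/-- `‖f‖²_{L²(𝕊³)}` for a real or complex valued function. -/
def normSqL2 {F : Type} [Norm F] (f : S3 → F) : ℝ := ∫ x, ‖f x‖ ^ 2 ∂dvol

/-- `‖f‖²_{H¹(𝕊³)} = ‖f‖²_{L²} + ‖∇̸f‖²_{L²}` for a real or complex valued function. -/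
def normSqH1 {F : Type} [NormedAddCommGroup F] [NormedSpace ℝ F] (f : S3 → F) : ℝ :=
  normSqL2 f + ∫ x, covecNormSq x (mvfderiv (𝓡 3) f x) ∂dvol

/-- `‖α‖²_{H¹(𝕊³)} = ‖α‖²_{L²} + ‖∇̸α‖²_{L²}` for a 1-form `α` on `𝕊³`. -/
def formNormSqH1 (α : ∀ x : S3, TangentSpace (𝓡 3) x →L[ℝ] ℝ) : ℝ :=
  (∫ x, covecNormSq x (α x) ∂dvol) + ∫ x, covecNormSq x (covDeriv α x) ∂dvol

/-! ### Fields on the Einstein cylinder -/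

/-- The Einstein cylinder `𝔈 = ℝ × 𝕊³`. -/
abbrev Cyl : Type := ℝ × S3

/-- The model with corners of `𝔈`; tangent vectors at `(τ, x)` are pairs in `ℝ × T_x𝕊³`. -/
abbrev modelCyl := 𝓘(ℝ, ℝ).prod (𝓡 3)

/-- The model vector space of `𝔈`. -/
abbrev ModelCyl : Type := ℝ × EuclideanSpace ℝ (Fin 3)

/-- The vector field `T = ∂/∂τ`. -/
def dtau (p : Cyl) : TangentSpace modelCyl p := ((1, 0) : ModelCyl)

/-- The inclusion of the vectors tangent to the slice `{τ} × 𝕊³`, as a linear map. -/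
def spatial (p : Cyl) : TangentSpace (𝓡 3) p.2 →L[ℝ] TangentSpace modelCyl p :=
  ContinuousLinearMap.inr ℝ ℝ (EuclideanSpace ℝ (Fin 3))

/-- The Lorentzian metric `𝔢 = dτ² - 𝔰₃`. -/
def metric (p : Cyl) (u v : TangentSpace modelCyl p) : ℝ :=
  (show ModelCyl from u).1 * (show ModelCyl from v).1 -
    roundMetric p.2 (show ModelCyl from u).2 (show ModelCyl from v).2

/-- Real 1-forms on `𝔈` (without regularity). -/
abbrev OneForm : Type := ∀ p : Cyl, TangentSpace modelCyl p →L[ℝ] ℝ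

/-- `A` is a 1-form of class `C¹`, i.e. a `C¹` section of the cotangent bundle of `𝔈`. -/
def IsC1Form (A : OneForm) : Prop :=
  ContMDiff modelCyl (modelCyl.prod 𝓘(ℝ, ModelCyl →L[ℝ] ℝ)) 1
    (fun p => Bundle.TotalSpace.mk' (ModelCyl →L[ℝ] ℝ)
      (E := fun p : Cyl => TangentSpace modelCyl p →L[ℝ] Bundle.Trivial Cyl ℝ p) p (A p))

/-- The component `A₀(τ)` along `∂_τ`, as a function on `𝕊³`. -/
def timePart (A : OneForm) (τ : ℝ) (x : S3) : ℝ := A (τ, x) (dtau (τ, x))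

/-- The projection `𝐀(τ)` of `A` onto `𝕊³`, as a 1-form on `𝕊³`. -/
def spacePart (A : OneForm) (τ : ℝ) (x : S3) : TangentSpace (𝓡 3) x →L[ℝ] ℝ :=
  (A (τ, x)).comp (spatial (τ, x))

/-- `∂_τ 𝐀 (τ)`, evaluated at `x` on a vector tangent to `𝕊³`. -/
def spacePartDot (A : OneForm) (τ : ℝ) (x : S3) (u : TangentSpace (𝓡 3) x) : ℝ :=
  deriv (fun s => spacePart A s x u) τ

/-- The Sobolev energy
`S₁[A](τ) = ‖∂_τ 𝐀‖²_{L²} + ‖𝐀‖²_{H¹} + ‖A₀‖²_{H¹}` of a 1-form. -/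
def sobolevEnergyForm (A : OneForm) (τ : ℝ) : ℝ :=
  (∫ x, covecNormSq x (spacePartDot A τ x) ∂dvol) + formNormSqH1 (spacePart A τ) +
    normSqH1 (timePart A τ)

/-- The Sobolev energy `S₁[ψ](τ) = ‖∂_τ ψ‖²_{L²} + ‖ψ‖²_{H¹}` of a complex scalar field. -/
def sobolevEnergy (ψ : Cyl → ℂ) (τ : ℝ) : ℝ :=
  normSqL2 (fun x => deriv (fun s => ψ (s, x)) τ) + normSqH1 (fun x => ψ (τ, x))

/-- The gauge covariant derivative `D_a ψ = ∇_a ψ + i A_a ψ`, evaluated on a vector. -/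
def gaugeD (A : OneForm) (ψ : Cyl → ℂ) (p : Cyl) (u : TangentSpace modelCyl p) : ℂ :=
  mvfderiv modelCyl ψ p u + Complex.I * (A p u : ℂ) * ψ p

/-- The contraction `conj(D_c ψ) D^c ψ` with the inverse of `𝔢 = dτ² - 𝔰₃`. -/
def gaugeDNormSq (A : OneForm) (ψ : Cyl → ℂ) (p : Cyl) : ℝ :=
  ‖gaugeD A ψ p (dtau p)‖ ^ 2 - covecNormSq p.2 (fun u => gaugeD A ψ p (spatial p u))

/-- The scalar field energy-momentum tensor
`T_ab[ψ] = conj(D_(a ψ) D_b) ψ - ½ 𝔢_ab conj(D_c ψ) D^c ψ + ½ 𝔢_ab |ψ|²`. -/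
def stressEnergy (A : OneForm) (ψ : Cyl → ℂ) (p : Cyl) (u v : TangentSpace modelCyl p) : ℝ :=
  ((starRingEnd ℂ) (gaugeD A ψ p u) * gaugeD A ψ p v).re
    - 1 / 2 * metric p u v * gaugeDNormSq A ψ p + 1 / 2 * metric p u v * ‖ψ p‖ ^ 2

/-- The geometric energy `𝓔_τ[ψ] = ∫_{𝕊³} T_ab[ψ] T^a T^b` on the slice `{τ} × 𝕊³`. -/
def geometricEnergy (A : OneForm) (ψ : Cyl → ℂ) (τ : ℝ) : ℝ :=
  ∫ x : S3, stressEnergy A ψ (τ, x) (dtau (τ, x)) (dtau (τ, x)) ∂dvol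

/-- `T_00[ψ] = ½ |D₀ψ|² + ½ |D̸ψ|² + ½ |ψ|²`. -/
theorem stressEnergy_dtau (A : OneForm) (ψ : Cyl → ℂ) (p : Cyl) :
    stressEnergy A ψ p (dtau p) (dtau p) =
      1 / 2 * ‖gaugeD A ψ p (dtau p)‖ ^ 2
        + 1 / 2 * covecNormSq p.2 (fun u => gaugeD A ψ p (spatial p u))
        + 1 / 2 * ‖ψ p‖ ^ 2 := by
  have hm : metric p (dtau p) (dtau p) = 1 := by
    have h0 : dIncl p.2 (0 : TangentSpace (𝓡 3) p.2) = 0 := map_zero _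
    have : roundMetric p.2 (0 : TangentSpace (𝓡 3) p.2) (0 : TangentSpace (𝓡 3) p.2) = 0 := by
      rw [roundMetric, h0, inner_zero_left]
    change (1 : ℝ) * 1 - roundMetric p.2 (0 : TangentSpace (𝓡 3) p.2) 0 = 1
    rw [this]; norm_num
  have hc : ((starRingEnd ℂ) (gaugeD A ψ p (dtau p)) * gaugeD A ψ p (dtau p)).re =
      ‖gaugeD A ψ p (dtau p)‖ ^ 2 := by
    rw [← Complex.normSq_eq_conj_mul_self, Complex.ofReal_re, Complex.normSq_eq_norm_sq]
  rw [stressEnergy, hm, hc, gaugeDNormSq]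
  ring

end EinsteinCylinder

end

open scoped Manifold ContDiff InnerProductSpace

noncomputable section

namespace EinsteinCylinder

/-! ### The radial projection `ℝ⁴ ∖ {0} → 𝕊³` -/

/-! The gauge covariant and ordinary derivatives of `ψ` differ by `iAψ`. Hence, up to numerical
factors, each energy is bounded by the other plus `∫ |A|² |ψ|²`. By Cauchy–Schwarz and the Sobolev
embedding `H¹(𝕊³) ⊂ L⁴(𝕊³)`, this integral is at most `K S₁[A] S₁[ψ]`
(`exists_integral_potentialDensity_le`). If `S₁[A]` is small, the term is absorbed into `S₁[ψ]`,
which gives the first inequality; for the second, boundedness of `S₁[A]` would do.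

The embedding (`exists_integral_norm_pow_four_le`) comes from flat space: a function on `𝕊³` is
extended to an annulus of `ℝ⁴`, constant along rays, and cut off. In dimension 4 the
Gagliardo–Nirenberg–Sobolev inequality takes `L²` gradients exactly to `L⁴`, and polar coordinates
return both sides to the sphere.

For the 1-form `𝐀` the embedding is applied to its dual field as an `ℝ⁴`-valued function. By the
Gauss formula (`covecNormSq_mvfderiv_sharp`) the flat derivative of this field exceeds the
Levi-Civita derivative only by a normal part of size `|𝐀|`.

Continuity of the densities has to be proved as well, since the Bochner integral of a non-integrable
function is `0`. The fields `frame j` are defined by choice; their regularity comes from being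
images of constant fields under the differential of the radial projection. -/

/-- The radial projection `y ↦ y / ‖y‖` onto the sphere, with a junk value at the origin. -/
def sphereProj (y : E4) : S3 :=
  if h : y = 0 then ⟨EuclideanSpace.single 0 1, by simp⟩
  else ⟨‖y‖⁻¹ • y, by simp [norm_smul, h]⟩

theorem coe_sphereProj {y : E4} (hy : y ≠ 0) : (sphereProj y : E4) = ‖y‖⁻¹ • y := by
  simp [sphereProj, hy]

@[simp] theorem sphereProj_coe (x : S3) : sphereProj x = x := by
  have hx : (x : E4) ≠ 0 := ne_zero_of_mem_unit_sphere x
  ext1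
  simp [coe_sphereProj hx]

theorem contMDiffAt_sphereProj {y : E4} (hy : y ≠ 0) :
    ContMDiffAt 𝓘(ℝ, E4) (𝓡 3) ω sphereProj y := by
  let U : TopologicalSpace.Opens E4 := ⟨{0}ᶜ, isOpen_compl_singleton⟩
  have h1 : ContMDiff 𝓘(ℝ, E4) 𝓘(ℝ, E4) ω (fun z : U => ‖(z : E4)‖⁻¹ • (z : E4)) := by
    intro z
    refine (contMDiffAt_subtype_iff (f := fun z : E4 => ‖z‖⁻¹ • z)).2 ?_
    have hz : (z : E4) ≠ 0 := z.2
    exact (((contDiffAt_norm ℝ hz).inv (norm_ne_zero_iff.2 hz)).smul contDiffAt_id).contMDiffAt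
  have h2 := h1.codRestrict_sphere (n := 3) (fun z => by
    have hz : (z : E4) ≠ 0 := z.2
    simp [norm_smul, hz])
  have h3 : (fun z : U => sphereProj (z : E4)) = Set.codRestrict
      (fun z : U => ‖(z : E4)‖⁻¹ • (z : E4)) (Metric.sphere (0 : E4) 1) (fun z => by
        have hz : (z : E4) ≠ 0 := z.2
        simp [norm_smul, hz]) := by
    ext1 z
    have hz : (z : E4) ≠ 0 := z.2
    ext1
    simp [coe_sphereProj hz]
  rw [← h3] at h2
  exact (contMDiffAt_subtype_iff (U := U) (x := ⟨y, hy⟩)).1 (h2 ⟨y, hy⟩)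

theorem fderiv_norm_inv_smul {y : E4} (hy : y ≠ 0) (w : E4) :
    fderiv ℝ (fun z : E4 => ‖z‖⁻¹ • z) y w = ‖y‖⁻¹ • tangProj (sphereProj y) w := by
  have hn : ‖y‖ ≠ 0 := norm_ne_zero_iff.2 hy
  -- The norm is treated as `√(‖y‖ ^ 2)`, so that only the square root and the inversion need a
  -- nonzero argument.
  have h0 := ((hasStrictFDerivAt_norm_sq y).hasFDerivAt).sqrt (by positivity)
  have h := ((hasDerivAt_inv (x := √(‖y‖ ^ 2)) (by positivity)).comp_hasFDerivAt y h0).smul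
    (hasFDerivAt_id (𝕜 := ℝ) y)
  have he : (fun z : E4 => ‖z‖⁻¹ • z) =
      ((fun r : ℝ => r⁻¹) ∘ fun y : E4 => √(‖y‖ ^ 2)) • (id : E4 → E4) := by
    ext1 z; simp
  rw [he, h.fderiv]
  simp only [tangProj, coe_sphereProj hy, Real.sqrt_sq (norm_nonneg y), Function.comp,
    inner_smul_left, add_apply, smul_apply,
    ContinuousLinearMap.smulRight_apply, innerSL_apply_apply, id, smul_smul,
    ContinuousLinearMap.id_apply, smul_eq_mul, sub_eq_add_neg, ← neg_smul]
  simp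
  field_simp
  rw [smul_smul]
  congr 1
  field_simp

theorem mdifferentiableAt_sphereProj {y : E4} (hy : y ≠ 0) :
    MDifferentiableAt 𝓘(ℝ, E4) (𝓡 3) sphereProj y :=
  (contMDiffAt_sphereProj hy).mdifferentiableAt (by simp)

theorem fderiv_comp_sphereProj {F : Type*} [NormedAddCommGroup F] [NormedSpace ℝ F] {f : S3 → F}
    {y : E4} (hy : y ≠ 0) (hf : MDifferentiableAt (𝓡 3) 𝓘(ℝ, F) f (sphereProj y)) (w : E4) :
    fderiv ℝ (f ∘ sphereProj) y w =
      mvfderiv (𝓡 3) f (sphereProj y) (mfderiv 𝓘(ℝ, E4) (𝓡 3) sphereProj y w) := by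
  have h := mfderiv_comp_apply y hf (mdifferentiableAt_sphereProj hy) w
  rw [mfderiv_eq_fderiv] at h
  exact h

theorem dIncl_mfderiv_sphereProj {y : E4} (hy : y ≠ 0) (w : E4) :
    dIncl (sphereProj y) (mfderiv 𝓘(ℝ, E4) (𝓡 3) sphereProj y w) =
      ‖y‖⁻¹ • tangProj (sphereProj y) w := by
  have hc : MDifferentiableAt (𝓡 3) 𝓘(ℝ, E4) ((↑) : S3 → E4) (sphereProj y) :=
    (contMDiff_coe_sphere (m := 1) _).mdifferentiableAt (by simp)
  rw [← fderiv_norm_inv_smul hy, dIncl, ← fderiv_comp_sphereProj hy hc]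
  congr 1
  refine Filter.EventuallyEq.fderiv_eq ?_
  filter_upwards [isOpen_ne.mem_nhds hy] with z hz
  exact coe_sphereProj hz

theorem dIncl_injective (x : S3) : Function.Injective (dIncl x) :=
  injective_mvfderiv_subtypeVal_sphere x

/-- Injectivity of `dIncl` pins down the chosen vectors `frame j`. Differentiation along the frame
thereby becomes differentiation in a fixed direction of `ℝ⁴`. -/
theorem mfderiv_sphereProj_single {y : E4} (hy : y ≠ 0) (j : Fin 4) :
    mfderiv 𝓘(ℝ, E4) (𝓡 3) sphereProj y (EuclideanSpace.single j (1 : ℝ) : E4) =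
      ‖y‖⁻¹ • frame j (sphereProj y) := by
  apply dIncl_injective
  rw [map_smul, dIncl_frame]
  exact dIncl_mfderiv_sphereProj hy _

theorem fderiv_comp_sphereProj_single {F : Type*} [NormedAddCommGroup F] [NormedSpace ℝ F]
    {f : S3 → F} {y : E4} (hy : y ≠ 0)
    (hf : MDifferentiableAt (𝓡 3) 𝓘(ℝ, F) f (sphereProj y)) (j : Fin 4) :
    fderiv ℝ (f ∘ sphereProj) y (EuclideanSpace.single j 1) =
      ‖y‖⁻¹ • mvfderiv (𝓡 3) f (sphereProj y) (frame j (sphereProj y)) := by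
  rw [fderiv_comp_sphereProj hy hf, ← map_smul]
  exact congrArg _ (mfderiv_sphereProj_single hy j)

theorem contDiffAt_comp_sphereProj {F : Type*} [NormedAddCommGroup F] [NormedSpace ℝ F]
    {f : S3 → F} {n : ℕ∞ω} (hf : ContMDiff (𝓡 3) 𝓘(ℝ, F) n f) {y : E4} (hy : y ≠ 0) :
    ContDiffAt ℝ n (f ∘ sphereProj) y :=
  ((hf _).comp y ((contMDiffAt_sphereProj hy).of_le le_top)).contDiffAt

theorem fderiv_comp_sphereProj_coe_single {F : Type*} [NormedAddCommGroup F] [NormedSpace ℝ F]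
    {f : S3 → F} (x : S3) (hf : MDifferentiableAt (𝓡 3) 𝓘(ℝ, F) f x) (j : Fin 4) :
    fderiv ℝ (f ∘ sphereProj) (x : E4) (EuclideanSpace.single j 1) =
      mvfderiv (𝓡 3) f x (frame j x) := by
  rw [fderiv_comp_sphereProj_single (ne_zero_of_mem_unit_sphere x) (by rwa [sphereProj_coe])]
  -- The tangent space depends on the base point, so `sphereProj x = x` is used by substituting a
  -- variable instead of rewriting.
  have h : ∀ z : S3, z = x → mvfderiv (𝓡 3) f z (frame j z) = mvfderiv (𝓡 3) f x (frame j x) := by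
    rintro z rfl; rfl
  simp [h _ (sphereProj_coe x)]

/-- The derivative of a `C¹` function along the frame fields is continuous. -/
theorem continuous_mvfderiv_frame {F : Type*} [NormedAddCommGroup F] [NormedSpace ℝ F]
    {f : S3 → F} (hf : ContMDiff (𝓡 3) 𝓘(ℝ, F) 1 f) (j : Fin 4) :
    Continuous fun x : S3 => mvfderiv (𝓡 3) f x (frame j x) := by
  simp_rw [← fun x : S3 => fderiv_comp_sphereProj_coe_single x ((hf x).mdifferentiableAt (by simp)) j]
  refine continuous_iff_continuousAt.2 fun x => ?_
  have h1 : ContinuousAt (fderiv ℝ (f ∘ sphereProj)) (x : E4) :=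
    ((contDiffAt_comp_sphereProj hf (ne_zero_of_mem_unit_sphere x)).fderiv_right
      (m := 0) (by simp)).continuousAt
  exact (h1.comp continuous_subtype_val.continuousAt).clm_apply continuousAt_const

/-- The squared operator norm is at most the sum of the squares over the standard basis. -/
theorem norm_sq_le_sum_single {F : Type*} [NormedAddCommGroup F] [NormedSpace ℝ F]
    (L : E4 →L[ℝ] F) : ‖L‖ ^ 2 ≤ ∑ j : Fin 4, ‖L (EuclideanSpace.single j 1)‖ ^ 2 := by
  set S := ∑ j : Fin 4, ‖L (EuclideanSpace.single j 1)‖ ^ 2 with hS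
  have hS0 : 0 ≤ S := by positivity
  have : ‖L‖ ≤ √S := by
    refine L.opNorm_le_bound (Real.sqrt_nonneg _) fun w => ?_
    have hw : w = ∑ j, w j • (EuclideanSpace.single j (1 : ℝ) : E4) := by
      ext i
      simp [Finset.sum_apply, Pi.single_apply]
    calc ‖L w‖ = ‖∑ j, w j • L (EuclideanSpace.single j 1)‖ := by
          conv_lhs => rw [hw]
          simp
      _ ≤ ∑ j, ‖L (EuclideanSpace.single j 1)‖ * ‖w j‖ := by
          refine (norm_sum_le _ _).trans (Finset.sum_le_sum fun j _ => ?_)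
          rw [norm_smul, mul_comm]
      _ ≤ √S * √(∑ j, ‖w j‖ ^ 2) := Real.sum_mul_le_sqrt_mul_sqrt _ _ _
      _ = √S * ‖w‖ := by rw [EuclideanSpace.norm_eq w]
  calc ‖L‖ ^ 2 ≤ √S ^ 2 := by gcongr
    _ = S := Real.sq_sqrt hS0

theorem norm_fderiv_comp_sphereProj_sq_le {F : Type} [NormedAddCommGroup F] [NormedSpace ℝ F]
    {f : S3 → F} {y : E4} (hy : y ≠ 0)
    (hf : MDifferentiableAt (𝓡 3) 𝓘(ℝ, F) f (sphereProj y)) :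
    ‖fderiv ℝ (f ∘ sphereProj) y‖ ^ 2 ≤
      (‖y‖⁻¹) ^ 2 * covecNormSq (sphereProj y) (mvfderiv (𝓡 3) f (sphereProj y)) := by
  refine (norm_sq_le_sum_single _).trans_eq ?_
  simp_rw [fderiv_comp_sphereProj_single hy hf, norm_smul, mul_pow, covecNormSq, Finset.mul_sum]
  simp

/-! ### Regularity of the components of a `C¹` form -/

/-- The map `(t, y) ↦ (t, y / ‖y‖)` onto the cylinder. -/
def cylProj (p : ℝ × E4) : Cyl := (p.1, sphereProj p.2)

theorem contMDiffAt_cylProj {p : ℝ × E4} (hp : p.2 ≠ 0) :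
    ContMDiffAt 𝓘(ℝ, ℝ × E4) modelCyl ω cylProj p :=
  contDiffAt_fst.contMDiffAt.prodMk
    (ContMDiffAt.comp p (contMDiffAt_sphereProj hp) contDiffAt_snd.contMDiffAt)

theorem mfderiv_cylProj {p : ℝ × E4} (hp : p.2 ≠ 0) (v : ℝ × E4) :
    mfderiv 𝓘(ℝ, ℝ × E4) modelCyl cylProj p v =
      ((v.1, mfderiv 𝓘(ℝ, E4) (𝓡 3) sphereProj p.2 v.2) : ModelCyl) := by
  have h1 : MDifferentiableAt 𝓘(ℝ, ℝ × E4) 𝓘(ℝ, ℝ) (Prod.fst : ℝ × E4 → ℝ) p :=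
    (contDiffAt_fst (n := 1)).contMDiffAt.mdifferentiableAt (by simp)
  have h2 : MDifferentiableAt 𝓘(ℝ, ℝ × E4) 𝓘(ℝ, E4) (Prod.snd : ℝ × E4 → E4) p :=
    (contDiffAt_snd (n := 1)).contMDiffAt.mdifferentiableAt (by simp)
  have h3 := mdifferentiableAt_sphereProj hp
  have h := mfderiv_prodMk h1 (h3.comp p h2)
  have h4 := mfderiv_comp p h3 h2
  rw [h4] at h
  rw [mfderiv_eq_fderiv, mfderiv_eq_fderiv, fderiv_fst, fderiv_snd] at h
  exact congrArg (fun L => L v) h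

/-- A `C¹` form is paired with the image of a constant vector under the differential of `cylProj`.
The pairing is `C¹` because `cylProj` is `C²` off the axis and its tangent map is therefore `C¹`. -/
theorem contDiffAt_form_cylProj {A : OneForm} (hA : IsC1Form A) (v : ℝ × E4) {p : ℝ × E4}
    (hp : p.2 ≠ 0) :
    ContDiffAt ℝ 1
      (fun q : ℝ × E4 => A (cylProj q) (mfderiv 𝓘(ℝ, ℝ × E4) modelCyl cylProj q v)) p := by
  have hs : IsOpen {q : ℝ × E4 | q.2 ≠ 0} := isOpen_ne_fun continuous_snd continuous_const
  have h1 : ContMDiffOn 𝓘(ℝ, ℝ × E4) modelCyl 2 cylProj {q : ℝ × E4 | q.2 ≠ 0} :=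
    fun q hq => ((contMDiffAt_cylProj hq).of_le le_top).contMDiffWithinAt
  have h2 := h1.contMDiffOn_tangentMapWithin (m := 1) (by norm_num) hs.uniqueMDiffOn
  have h3 : ContMDiff 𝓘(ℝ, ℝ × E4) 𝓘(ℝ, ℝ × E4).tangent 1
      (fun q : ℝ × E4 => (⟨q, v⟩ : TangentBundle 𝓘(ℝ, ℝ × E4) (ℝ × E4))) :=
    contMDiff_vectorSpace_iff_contDiff.2 contDiff_const
  have h4 : ContMDiffAt 𝓘(ℝ, ℝ × E4) modelCyl.tangent 1
      (fun q : ℝ × E4 => (⟨cylProj q, mfderiv 𝓘(ℝ, ℝ × E4) modelCyl cylProj q v⟩ :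
        TangentBundle modelCyl Cyl)) p := by
    have h5 := (h2.comp h3.contMDiffOn (s := {q : ℝ × E4 | q.2 ≠ 0}) (fun q hq => hq)).contMDiffAt
      (hs.mem_nhds hp)
    refine h5.congr_of_eventuallyEq ?_
    filter_upwards [hs.mem_nhds hp] with q hq
    simp only [Function.comp, tangentMapWithin]
    rw [mfderivWithin_of_isOpen hs hq]
  have h6 := (hA (cylProj p)).comp p ((contMDiffAt_cylProj hp).of_le le_top)
  have h7 := ContMDiffAt.clm_bundle_apply (F₂ := ℝ) (E₂ := Bundle.Trivial Cyl ℝ) (IB := modelCyl)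
    (ϕ := fun q => A (cylProj q)) (b := cylProj)
    (v := fun q => mfderiv 𝓘(ℝ, ℝ × E4) modelCyl cylProj q v) h6 h4
  rw [Bundle.contMDiffAt_totalSpace] at h7
  exact h7.2.contDiffAt

theorem contMDiff_timePart {A : OneForm} (hA : IsC1Form A) (τ : ℝ) :
    ContMDiff (𝓡 3) 𝓘(ℝ, ℝ) 1 (timePart A τ) := by
  have h : timePart A τ = fun x : S3 => A (cylProj (τ, x))
      (mfderiv 𝓘(ℝ, ℝ × E4) modelCyl cylProj (τ, (x : E4)) ((1, 0) : ℝ × E4)) := by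
    ext1 x
    have h1 : ∀ z : S3, z = x → timePart A τ x = A (τ, z) ((1, 0) : ModelCyl) := by
      rintro z rfl; rfl
    rw [h1 _ (sphereProj_coe x)]
    refine congrArg (A (cylProj (τ, x))) ?_
    rw [mfderiv_cylProj (p := (τ, (x : E4))) (ne_zero_of_mem_unit_sphere x)]
    exact congrArg (Prod.mk (1 : ℝ)) (map_zero _).symm
  rw [h]
  intro x
  have h2 : ContMDiff (𝓡 3) 𝓘(ℝ, ℝ × E4) 1 (fun x : S3 => (τ, (x : E4))) :=
    contMDiff_const.prodMk_space contMDiff_coe_sphere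
  exact ContMDiffAt.comp x (contDiffAt_form_cylProj hA (1, 0) (p := (τ, (x : E4)))
    (ne_zero_of_mem_unit_sphere x)).contMDiffAt (h2 x)

theorem contMDiff_spacePart_frame {A : OneForm} (hA : IsC1Form A) (τ : ℝ) (j : Fin 4) :
    ContMDiff (𝓡 3) 𝓘(ℝ, ℝ) 1 (fun x => spacePart A τ x (frame j x)) := by
  have h : (fun x => spacePart A τ x (frame j x)) = fun x : S3 => A (cylProj (τ, x))
      (mfderiv 𝓘(ℝ, ℝ × E4) modelCyl cylProj (τ, (x : E4))
        ((0, EuclideanSpace.single j 1) : ℝ × E4)) := by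
    ext1 x
    have h1 : ∀ z : S3, z = x →
        spacePart A τ x (frame j x) = A (τ, z) ((0, frame j z) : ModelCyl) := by
      rintro z rfl; rfl
    rw [h1 _ (sphereProj_coe x)]
    refine congrArg (A (cylProj (τ, x))) ?_
    rw [mfderiv_cylProj (p := (τ, (x : E4))) (ne_zero_of_mem_unit_sphere x)]
    refine congrArg (Prod.mk (0 : ℝ)) ?_
    refine Eq.trans ?_ (mfderiv_sphereProj_single (ne_zero_of_mem_unit_sphere x) j).symm
    simp
    rfl
  rw [h]
  intro x
  have h2 : ContMDiff (𝓡 3) 𝓘(ℝ, ℝ × E4) 1 (fun x : S3 => (τ, (x : E4))) :=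
    contMDiff_const.prodMk_space contMDiff_coe_sphere
  exact ContMDiffAt.comp x (contDiffAt_form_cylProj hA (0, EuclideanSpace.single j 1)
    (p := (τ, (x : E4))) (ne_zero_of_mem_unit_sphere x)).contMDiffAt (h2 x)

/-! ### The dual vector field and the Gauss formula -/

theorem inner_dIncl_frame (x : S3) (w : E4) (hw : ⟪(x : E4), w⟫_ℝ = 0) (j : Fin 4) :
    ⟪w, dIncl x (frame j x)⟫_ℝ = w j := by
  rw [dIncl_frame, tangProj, inner_sub_right, inner_smul_right, real_inner_comm (x : E4) w, hw]
  simp [EuclideanSpace.inner_single_right]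

theorem inner_coe_sharp (α : ∀ x : S3, TangentSpace (𝓡 3) x →L[ℝ] ℝ) (x : S3) :
    ⟪(x : E4), sharp α x⟫_ℝ = 0 := by
  simp [sharp, inner_sum, inner_smul_right, inner_dIncl]

/-- In the standard basis of `ℝ⁴`, the components of the dual field are those of the form along
the frame. -/
theorem sharp_apply (α : ∀ x : S3, TangentSpace (𝓡 3) x →L[ℝ] ℝ) (x : S3) (j : Fin 4) :
    sharp α x j = α x (frame j x) := by
  rw [← inner_sharp α x (frame j x), inner_dIncl_frame x _ (inner_coe_sharp α x)]

theorem norm_sharp_sq (α : ∀ x : S3, TangentSpace (𝓡 3) x →L[ℝ] ℝ) (x : S3) :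
    ‖sharp α x‖ ^ 2 = covecNormSq x (α x) := by
  simp [EuclideanSpace.norm_sq_eq, covecNormSq, sharp_apply]

theorem contMDiff_sharp_spacePart {A : OneForm} (hA : IsC1Form A) (τ : ℝ) :
    ContMDiff (𝓡 3) 𝓘(ℝ, E4) 1 (sharp (spacePart A τ)) := by
  have h : sharp (spacePart A τ) =
      fun x => ∑ j, spacePart A τ x (frame j x) • (EuclideanSpace.single j (1 : ℝ) : E4) := by
    ext x i
    simp [sharp_apply, Finset.sum_apply, Pi.single_apply]
  rw [h]
  exact contMDiff_finsetSum fun j _ => (contMDiff_spacePart_frame hA τ j).smul contMDiff_const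

/-- Gauss formula: the derivative of the dual field in `ℝ⁴` is its tangential part, the covariant
derivative, plus its normal part, `-α` times the normal. -/
theorem covecNormSq_mvfderiv_sharp {α : ∀ x : S3, TangentSpace (𝓡 3) x →L[ℝ] ℝ} (x : S3)
    (hα : MDifferentiableAt (𝓡 3) 𝓘(ℝ, E4) (sharp α) x) :
    covecNormSq x (mvfderiv (𝓡 3) (sharp α) x) =
      covecNormSq x (covDeriv α x) + covecNormSq x (α x) := by
  -- Differentiate the identity `⟪x, sharp α x⟫ = 0` along `E_j`, after extending both factors
  -- radially so that the product rule in `ℝ⁴` applies.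
  have hperp : ∀ j, ⟪(x : E4), mvfderiv (𝓡 3) (sharp α) x (frame j x)⟫_ℝ = - α x (frame j x) := by
    intro j
    have hx : (x : E4) ≠ 0 := ne_zero_of_mem_unit_sphere x
    have hc : MDifferentiableAt (𝓡 3) 𝓘(ℝ, E4) ((↑) : S3 → E4) x :=
      (contMDiff_coe_sphere (m := 1) _).mdifferentiableAt (by simp)
    have hd : ∀ f : S3 → E4, MDifferentiableAt (𝓡 3) 𝓘(ℝ, E4) f x →
        DifferentiableAt ℝ (f ∘ sphereProj) (x : E4) := fun f hf =>
      (MDifferentiableAt.comp (x : E4) (by rwa [sphereProj_coe])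
        (mdifferentiableAt_sphereProj hx)).differentiableAt
    have h0 : (fun y => ⟪(((↑) : S3 → E4) ∘ sphereProj) y, (sharp α ∘ sphereProj) y⟫_ℝ) =
        fun _ => 0 := funext fun y => inner_coe_sharp α _
    have h1 := fderiv_inner_apply ℝ (hd _ hc) (hd _ hα) (EuclideanSpace.single j 1)
    rw [h0, fderiv_comp_sphereProj_coe_single x hc, fderiv_comp_sphereProj_coe_single x hα] at h1
    have h2 := inner_sharp α x (frame j x)
    rw [real_inner_comm] at h2
    simp only [Function.comp, sphereProj_coe] at h1
    change _ = _ + ⟪dIncl x (frame j x), _⟫_ℝ at h1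
    rw [h2] at h1
    simp at h1
    linarith
  rw [covecNormSq, covecNormSq, covecNormSq, ← Finset.sum_add_distrib]
  refine Finset.sum_congr rfl fun j _ => ?_
  set w := mvfderiv (𝓡 3) (sharp α) x (frame j x)
  have h1 : covDeriv α x (frame j x) = w - ⟪(x : E4), w⟫_ℝ • (x : E4) := rfl
  have h2 : ⟪(x : E4), w⟫_ℝ = - α x (frame j x) := hperp j
  rw [h1, @norm_sub_sq_real, inner_smul_right, norm_smul, ← real_inner_comm w, h2]
  simp
  ring

open MeasureTheory
open scoped ENNReal NNReal

/-! ### Integration in polar coordinates -/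

instance isFiniteMeasure_dvol : IsFiniteMeasure dvol := by
  unfold dvol; infer_instance

theorem _root_.Continuous.integrable_dvol {F : Type*} [NormedAddCommGroup F] {f : S3 → F}
    (hf : Continuous f) : Integrable f dvol :=
  hf.integrable_of_hasCompactSupport (HasCompactSupport.of_compactSpace f)

/-- The radial part of Lebesgue measure on `ℝ⁴`. -/
abbrev radialMeasure : Measure (Set.Ioi (0 : ℝ)) := Measure.volumeIoiPow 3

theorem lintegral_norm_mul_sphereProj {h : ℝ → ℝ≥0∞} {g : S3 → ℝ≥0∞} (hh : Measurable h)
    (hg : Measurable g) :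
    ∫⁻ y : E4, h ‖y‖ * g (sphereProj y) =
      (∫⁻ x, g x ∂dvol) * ∫⁻ r : Set.Ioi (0 : ℝ), h r ∂radialMeasure := by
  have hmp := (volume : Measure E4).measurePreserving_homeomorphUnitSphereProd
  have h1 := hmp.lintegral_comp_emb (Homeomorph.measurableEmbedding _)
    (fun p : S3 × Set.Ioi (0 : ℝ) => g p.1 * h p.2)
  have hd : Module.finrank ℝ E4 - 1 = 3 := by simp
  rw [hd] at h1
  have h2 := h1.trans (lintegral_prod_mul (μ := dvol) (ν := radialMeasure) (f := g)
    (g := fun r => h r) hg.aemeasurable (hh.comp measurable_subtype_coe).aemeasurable)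
  -- The origin is a null set, so the junk value of `sphereProj` there does not matter.
  rw [← h2, ← lintegral_add_compl _ (measurableSet_singleton (0 : E4))]
  rw [Measure.restrict_singleton]
  simp only [measure_singleton, zero_smul, lintegral_zero_measure, zero_add]
  rw [← lintegral_subtype_comap (measurableSet_singleton (0 : E4)).compl]
  refine lintegral_congr fun y => ?_
  have hy : (y : E4) ≠ 0 := y.2
  have h3 : (homeomorphUnitSphereProd E4 y).1 = sphereProj y := by
    ext1; simp [coe_sphereProj hy]
  rw [h3, mul_comm]
  simp

/-- This is the radial mass of a shell where `cutoff` is `1`; the Sobolev constant is obtained by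
dividing by it. -/
theorem radialMeasure_Ico_pos : 0 < radialMeasure {r | (r : ℝ) ∈ Set.Ico (1 : ℝ) (11 / 10)} := by
  have h1 : {r : Set.Ioi (0 : ℝ) | (r : ℝ) ∈ Set.Ico (1 : ℝ) (11 / 10)} =
      Set.Iio ⟨11 / 10, by norm_num [Set.mem_Ioi]⟩ \ Set.Iio ⟨1, by norm_num [Set.mem_Ioi]⟩ := by
    ext r
    simp [← Subtype.coe_le_coe, ← Subtype.coe_lt_coe]
  rw [h1]
  refine lt_of_lt_of_le ?_ le_measure_sdiff
  rw [radialMeasure, Measure.volumeIoiPow_apply_Iio, Measure.volumeIoiPow_apply_Iio, tsub_pos_iff_lt]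
  rw [ENNReal.ofReal_lt_ofReal_iff (by norm_num)]
  norm_num

theorem radialMeasure_lt_top {s : Set ℝ} (hs : ∀ r ∈ s, r < 2) :
    radialMeasure {r | (r : ℝ) ∈ s} < ⊤ := by
  refine lt_of_le_of_lt (measure_mono (t := Set.Iio ⟨2, by norm_num [Set.mem_Ioi]⟩) fun r hr => ?_) ?_
  · exact hs _ hr
  · rw [radialMeasure, Measure.volumeIoiPow_apply_Iio]
    exact ENNReal.ofReal_lt_top

theorem lintegral_indicator_norm_mul_sphereProj {s : Set ℝ} (hs : MeasurableSet s)
    {g : S3 → ℝ≥0∞} (hg : Measurable g) :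
    ∫⁻ y : E4, s.indicator 1 ‖y‖ * g (sphereProj y) =
      (∫⁻ x, g x ∂dvol) * radialMeasure {r | (r : ℝ) ∈ s} := by
  rw [lintegral_norm_mul_sphereProj (measurable_one.indicator hs) hg]
  congr 1
  exact lintegral_indicator_one (measurable_subtype_coe hs)

/-! ### The Sobolev inequality `H¹(𝕊³) ⊂ L⁴(𝕊³)` -/

/-- A radial cutoff function on `ℝ⁴`, equal to `1` near the unit sphere and supported in an
annulus. -/
def cutoff (y : E4) : ℝ :=
  (⟨1 / 4, 1 / 2, by norm_num, by norm_num⟩ : ContDiffBump (1 : ℝ)) (‖y‖ ^ 2)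

theorem contDiff_cutoff : ContDiff ℝ 1 cutoff :=
  (ContDiffBump.contDiff _).comp (contDiff_norm_sq ℝ)

theorem cutoff_eq_one {y : E4} (hy : ‖y‖ ∈ Set.Ico (1 : ℝ) (11 / 10)) : cutoff y = 1 := by
  refine ContDiffBump.one_of_mem_closedBall _ ?_
  -- The shell fits because `(11/10)² = 1.21` is below `1 + 1/4`.
  rw [Metric.mem_closedBall, Real.dist_eq, abs_le]
  obtain ⟨h1, h2⟩ := hy
  constructor
  · change -(1 / 4 : ℝ) ≤ _
    nlinarith
  · change _ ≤ (1 / 4 : ℝ)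
    nlinarith

theorem cutoff_eq_zero {y : E4} (hy : ‖y‖ ^ 2 ∉ Set.Icc (1 / 2 : ℝ) (3 / 2)) : cutoff y = 0 := by
  refine ContDiffBump.zero_of_le_dist _ ?_
  rw [Real.dist_eq]
  change (1 / 2 : ℝ) ≤ _
  by_contra! h
  rw [abs_lt] at h
  exact hy ⟨by linarith, by linarith⟩

theorem abs_cutoff_le_one (y : E4) : |cutoff y| ≤ 1 :=
  (abs_of_nonneg (ContDiffBump.nonneg _)).trans_le (ContDiffBump.le_one _)

theorem eventually_cutoff_eq_zero {y : E4} (hy : ‖y‖ ^ 2 ∉ Set.Icc (1 / 2 : ℝ) (3 / 2)) :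
    ∀ᶠ z in nhds y, cutoff z = 0 := by
  have ho : IsOpen {z : E4 | ‖z‖ ^ 2 ∉ Set.Icc (1 / 2 : ℝ) (3 / 2)} :=
    (isClosed_Icc.preimage (continuous_norm.pow 2)).isOpen_compl
  filter_upwards [ho.mem_nhds hy] with z hz using cutoff_eq_zero hz

theorem cutoff_eq_zero_of_notMem_closedBall {y : E4} (hy : y ∉ Metric.closedBall (0 : E4) 2) :
    cutoff y = 0 := by
  refine cutoff_eq_zero fun h => hy ?_
  rw [mem_closedBall_zero_iff]
  nlinarith [h.2, norm_nonneg y]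

theorem hasCompactSupport_cutoff_smul {F : Type*} [NormedAddCommGroup F] [NormedSpace ℝ F]
    (g : E4 → F) : HasCompactSupport fun y => cutoff y • g y :=
  HasCompactSupport.intro (isCompact_closedBall 0 2) fun y hy => by
    rw [cutoff_eq_zero_of_notMem_closedBall hy, zero_smul]

theorem exists_norm_fderiv_cutoff_le : ∃ M, ∀ y, ‖fderiv ℝ cutoff y‖ ≤ M := by
  refine Continuous.bounded_above_of_compact_support (contDiff_cutoff.continuous_fderiv (by simp)) ?_
  refine HasCompactSupport.fderiv ℝ ?_
  exact HasCompactSupport.intro (isCompact_closedBall 0 2) fun y hy =>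
    cutoff_eq_zero_of_notMem_closedBall hy

theorem ne_zero_of_norm_sq_mem {y : E4} (hy : ‖y‖ ^ 2 ∈ Set.Icc (1 / 2 : ℝ) (3 / 2)) : y ≠ 0 := by
  rintro rfl
  norm_num at hy

section Sobolev

variable {F : Type} [NormedAddCommGroup F] [NormedSpace ℝ F]

/-- The only singularity of the radial extension is the origin, and `cutoff` vanishes in a
neighbourhood of it. -/
theorem contDiff_cutoff_smul {f : S3 → F} (hf : ContMDiff (𝓡 3) 𝓘(ℝ, F) 1 f) :
    ContDiff ℝ 1 fun y => cutoff y • (f ∘ sphereProj) y := by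
  refine contDiff_iff_contDiffAt.2 fun y => ?_
  by_cases hy : ‖y‖ ^ 2 ∈ Set.Icc (1 / 2 : ℝ) (3 / 2)
  · exact contDiff_cutoff.contDiffAt.smul
      (contDiffAt_comp_sphereProj hf (ne_zero_of_norm_sq_mem hy))
  · refine (contDiffAt_const (c := (0 : F))).congr_of_eventuallyEq ?_
    filter_upwards [eventually_cutoff_eq_zero hy] with z hz
    rw [hz, zero_smul]

/-- The density of the square of the `H¹` norm. -/
def densityH1 (f : S3 → F) (x : S3) : ℝ := ‖f x‖ ^ 2 + covecNormSq x (mvfderiv (𝓡 3) f x)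

theorem covecNormSq_nonneg {F : Type} [NormedAddCommGroup F] (x : S3)
    (η : TangentSpace (𝓡 3) x → F) : 0 ≤ covecNormSq x η :=
  Finset.sum_nonneg fun _ _ => by positivity

theorem densityH1_nonneg (f : S3 → F) (x : S3) : 0 ≤ densityH1 f x :=
  add_nonneg (by positivity) (covecNormSq_nonneg _ _)

theorem normSqH1_nonneg (f : S3 → F) : 0 ≤ normSqH1 f :=
  add_nonneg (integral_nonneg fun _ => by positivity)
    (integral_nonneg fun _ => covecNormSq_nonneg _ _)

theorem continuous_covecNormSq_mvfderiv {f : S3 → F} (hf : ContMDiff (𝓡 3) 𝓘(ℝ, F) 1 f) :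
    Continuous fun x => covecNormSq x (mvfderiv (𝓡 3) f x) :=
  continuous_finsetSum _ fun j _ => (continuous_mvfderiv_frame hf j).norm.pow 2

theorem continuous_densityH1 {f : S3 → F} (hf : ContMDiff (𝓡 3) 𝓘(ℝ, F) 1 f) :
    Continuous (densityH1 f) :=
  (hf.continuous.norm.pow 2).add (continuous_covecNormSq_mvfderiv hf)

theorem integral_densityH1 {f : S3 → F} (hf : ContMDiff (𝓡 3) 𝓘(ℝ, F) 1 f) :
    ∫ x, densityH1 f x ∂dvol = normSqH1 f :=
  integral_add (hf.continuous.norm.pow 2).integrable_dvol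
    (continuous_covecNormSq_mvfderiv hf).integrable_dvol

/-- On the annulus `‖y‖⁻² ≤ 2`, so the extension has squared gradient at most `2N`, with `N` the
squared gradient on the sphere. The product rule and `(a + b)² ≤ 2a² + 2b²` then give `4N +
2M²|f|²`. -/
theorem norm_fderiv_cutoff_smul_sq_le {M : ℝ} (hM : ∀ y, ‖fderiv ℝ cutoff y‖ ≤ M)
    {f : S3 → F} (hf : ContMDiff (𝓡 3) 𝓘(ℝ, F) 1 f) {y : E4}
    (hy : ‖y‖ ^ 2 ∈ Set.Icc (1 / 2 : ℝ) (3 / 2)) :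
    ‖fderiv ℝ (fun y => cutoff y • (f ∘ sphereProj) y) y‖ ^ 2 ≤
      (4 + 2 * M ^ 2) * densityH1 f (sphereProj y) := by
  have hy0 := ne_zero_of_norm_sq_mem hy
  have h1 := norm_fderiv_comp_sphereProj_sq_le hy0 ((hf _).mdifferentiableAt (by simp))
  have h2 : (‖y‖⁻¹) ^ 2 ≤ 2 := by
    rw [inv_pow]
    exact inv_le_of_inv_le₀ (by norm_num) (by simpa using hy.1)
  rw [fderiv_fun_smul (contDiff_cutoff.contDiffAt.differentiableAt (by simp))
    ((contDiffAt_comp_sphereProj hf hy0).differentiableAt (by simp))]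
  set D := fderiv ℝ (f ∘ sphereProj) y
  set N := covecNormSq (sphereProj y) (mvfderiv (𝓡 3) f (sphereProj y)) with hN
  have hN0 : 0 ≤ N := covecNormSq_nonneg _ _
  have h3 : ‖cutoff y • D + (fderiv ℝ cutoff y).smulRight ((f ∘ sphereProj) y)‖ ≤
      ‖D‖ + M * ‖f (sphereProj y)‖ := by
    refine (norm_add_le _ _).trans (add_le_add ?_ ?_)
    · rw [norm_smul]
      exact mul_le_of_le_one_left (norm_nonneg _) (abs_cutoff_le_one y)
    · rw [ContinuousLinearMap.norm_smulRight_apply]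
      exact mul_le_mul_of_nonneg_right (hM y) (norm_nonneg _)
  have h4 : ‖D‖ ^ 2 ≤ 2 * N := h1.trans (mul_le_mul_of_nonneg_right h2 hN0)
  calc _ ≤ (‖D‖ + M * ‖f (sphereProj y)‖) ^ 2 := by gcongr
    _ ≤ 2 * (‖D‖ ^ 2 + (M * ‖f (sphereProj y)‖) ^ 2) := add_sq_le
    _ ≤ (4 + 2 * M ^ 2) * (‖f (sphereProj y)‖ ^ 2 + N) := by
      nlinarith [mul_nonneg (sq_nonneg M) hN0, sq_nonneg ‖f (sphereProj y)‖]

theorem lintegral_norm_fderiv_cutoff_smul_sq_le {M : ℝ} (hM : ∀ y, ‖fderiv ℝ cutoff y‖ ≤ M)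
    {f : S3 → F} (hf : ContMDiff (𝓡 3) 𝓘(ℝ, F) 1 f) :
    ∫⁻ y, ‖fderiv ℝ (fun y => cutoff y • (f ∘ sphereProj) y) y‖ₑ ^ (2 : ℝ) ≤
      ENNReal.ofReal (4 + 2 * M ^ 2) * ((∫⁻ x, ENNReal.ofReal (densityH1 f x) ∂dvol) *
        radialMeasure {r | (r : ℝ) ∈ {r : ℝ | r ^ 2 ∈ Set.Icc (1 / 2 : ℝ) (3 / 2)}}) := by
  have hs : MeasurableSet {r : ℝ | r ^ 2 ∈ Set.Icc (1 / 2 : ℝ) (3 / 2)} :=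
    (measurable_id.pow_const 2) measurableSet_Icc
  rw [← lintegral_indicator_norm_mul_sphereProj hs (g := fun x => ENNReal.ofReal (densityH1 f x))
      (ENNReal.measurable_ofReal.comp (continuous_densityH1 hf).measurable),
    ← lintegral_const_mul' _ _ ENNReal.ofReal_ne_top]
  refine lintegral_mono fun y => ?_
  dsimp only
  by_cases hy : ‖y‖ ^ 2 ∈ Set.Icc (1 / 2 : ℝ) (3 / 2)
  · rw [Set.indicator_of_mem (by exact hy), Pi.one_apply, one_mul,
      ← ENNReal.ofReal_mul (by positivity), ← ofReal_norm,
      ENNReal.ofReal_rpow_of_nonneg (norm_nonneg _) (by norm_num), Real.rpow_two]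
    exact ENNReal.ofReal_le_ofReal (norm_fderiv_cutoff_smul_sq_le hM hf hy)
  · have h0 : (fun y => cutoff y • (f ∘ sphereProj) y) =ᶠ[nhds y] fun _ => 0 := by
      filter_upwards [eventually_cutoff_eq_zero hy] with z hz
      rw [hz, zero_smul]
    rw [h0.fderiv_eq, fderiv_fun_const, Pi.zero_apply, ← ofReal_norm, norm_zero]
    simp

theorem lintegral_norm_pow_four_le_cutoff_smul {f : S3 → F} (hf : ContMDiff (𝓡 3) 𝓘(ℝ, F) 1 f) :
    (∫⁻ x, ‖f x‖ₑ ^ (4 : ℝ) ∂dvol) * radialMeasure {r | (r : ℝ) ∈ Set.Ico (1 : ℝ) (11 / 10)} ≤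
      ∫⁻ y, ‖cutoff y • (f ∘ sphereProj) y‖ₑ ^ (4 : ℝ) := by
  rw [← lintegral_indicator_norm_mul_sphereProj measurableSet_Ico
    (hf.continuous.enorm.measurable.pow_const 4)]
  refine lintegral_mono fun y => ?_
  dsimp only
  by_cases hy : ‖y‖ ∈ Set.Ico (1 : ℝ) (11 / 10)
  · rw [Set.indicator_of_mem hy, cutoff_eq_one hy]
    simp
  · rw [Set.indicator_of_notMem hy]
    simp

/-- The Sobolev inequality on `𝕊³`, derived from the one on `ℝ⁴`, where the critical exponent
of `H¹` is `4`. -/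
theorem exists_integral_norm_pow_four_le [FiniteDimensional ℝ F] :
    ∃ K : ℝ, 0 ≤ K ∧ ∀ f : S3 → F, ContMDiff (𝓡 3) 𝓘(ℝ, F) 1 f →
      ∫ x, ‖f x‖ ^ 4 ∂dvol ≤ K * normSqH1 f ^ 2 := by
  obtain ⟨M, hM⟩ := exists_norm_fderiv_cutoff_le
  set C : ℝ≥0 := SNormLESNormFDerivOfEqConst F (volume : Measure E4) (2 : ℝ≥0)
  set a := radialMeasure {r | (r : ℝ) ∈ Set.Ico (1 : ℝ) (11 / 10)} with ha
  set b := radialMeasure {r | (r : ℝ) ∈ {r : ℝ | r ^ 2 ∈ Set.Icc (1 / 2 : ℝ) (3 / 2)}} with hb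
  have ha0 : a ≠ 0 := radialMeasure_Ico_pos.ne'
  have hat : a ≠ ⊤ := (radialMeasure_lt_top fun r hr => by linarith [hr.2]).ne
  have hbt : b ≠ ⊤ := (radialMeasure_lt_top fun r hr => by nlinarith [hr.2]).ne
  -- `b` is the radial mass of the annulus carrying the gradient, `a` that of the shell where the
  -- cutoff is `1`; `C` enters to the fourth power with the `L⁴` norm.
  set K : ℝ≥0∞ := (C : ℝ≥0∞) ^ 4 * (ENNReal.ofReal (4 + 2 * M ^ 2) * b) ^ 2 / a with hK
  have hKt : K ≠ ⊤ := by
    refine ENNReal.div_ne_top (ENNReal.mul_ne_top (ENNReal.pow_ne_top ENNReal.coe_ne_top) ?_) ha0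
    exact ENNReal.pow_ne_top (ENNReal.mul_ne_top ENNReal.ofReal_ne_top hbt)
  refine ⟨K.toReal, ENNReal.toReal_nonneg, fun f hf => ?_⟩
  -- The exponents satisfy `1/4 = 1/2 - 1/4`, the last term being the inverse of the dimension.
  have hgns := eLpNorm_le_eLpNorm_fderiv_of_eq (F := F) (volume : Measure E4) (p := 2) (p' := 4)
    (contDiff_cutoff_smul hf) (hasCompactSupport_cutoff_smul _) (by norm_num) (by simp)
    (by simp; norm_num)
  have h1 := lintegral_norm_fderiv_cutoff_smul_sq_le hM hf
  have h2 := lintegral_norm_pow_four_le_cutoff_smul hf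
  set u := fun y => cutoff y • (f ∘ sphereProj) y
  have h3 : ∫⁻ y, ‖u y‖ₑ ^ (4 : ℝ) ≤ (C : ℝ≥0∞) ^ 4 * (∫⁻ y, ‖fderiv ℝ u y‖ₑ ^ (2 : ℝ)) ^ 2 := by
    have e4 := eLpNorm_nnreal_pow_eq_lintegral (f := u) (μ := volume) (p := 4) (by norm_num)
    have e2 := eLpNorm_nnreal_pow_eq_lintegral (f := fderiv ℝ u) (μ := volume) (p := 2) (by norm_num)
    simp only [NNReal.coe_ofNat] at e4 e2
    have h4 : ∀ z : ℝ≥0∞, z ^ (4 : ℝ) = z ^ 4 := fun z => by exact_mod_cast ENNReal.rpow_natCast z 4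
    rw [← e4, ← e2, h4, ENNReal.rpow_two, ← pow_mul, ← mul_pow]
    exact pow_le_pow_left' hgns 4
  have h4 : ∫⁻ x, ‖f x‖ₑ ^ (4 : ℝ) ∂dvol = ENNReal.ofReal (∫ x, ‖f x‖ ^ 4 ∂dvol) := by
    rw [ofReal_integral_eq_lintegral_ofReal (f := fun x => ‖f x‖ ^ 4)
      (hf.continuous.norm.pow 4).integrable_dvol
      (Filter.Eventually.of_forall fun x => pow_nonneg (norm_nonneg _) 4)]
    refine lintegral_congr fun x => ?_
    rw [← ofReal_norm, ENNReal.ofReal_rpow_of_nonneg (norm_nonneg _) (by norm_num)]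
    norm_cast
  have h5 : ∫⁻ x, ENNReal.ofReal (densityH1 f x) ∂dvol = ENNReal.ofReal (normSqH1 f) := by
    rw [← integral_densityH1 hf, ofReal_integral_eq_lintegral_ofReal
      (continuous_densityH1 hf).integrable_dvol (Filter.Eventually.of_forall (densityH1_nonneg f))]
  have h6 := normSqH1_nonneg f
  rw [h4] at h2
  rw [h5] at h1
  have h7 : ENNReal.ofReal (∫ x, ‖f x‖ ^ 4 ∂dvol) ≤ K * ENNReal.ofReal (normSqH1 f) ^ 2 := by
    rw [hK, ← ENNReal.mul_div_right_comm, ENNReal.le_div_iff_mul_le (Or.inl ha0) (Or.inl hat)]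
    refine (h2.trans h3).trans ((mul_le_mul_right (pow_le_pow_left' h1 2) _).trans_eq ?_)
    ring
  rwa [← ENNReal.ofReal_toReal hKt, ← ENNReal.ofReal_pow h6,
    ← ENNReal.ofReal_mul ENNReal.toReal_nonneg, ENNReal.ofReal_le_ofReal_iff (by positivity)] at h7

end Sobolev

/-! ### Comparison of the energies -/

/-- The product estimate `‖|g| |f|‖_{L²} ≲ ‖g‖_{H¹} ‖f‖_{H¹}`. -/
theorem exists_integral_norm_sq_mul_norm_sq_le (F G : Type) [NormedAddCommGroup F] [NormedSpace ℝ F]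
    [FiniteDimensional ℝ F] [NormedAddCommGroup G] [NormedSpace ℝ G] [FiniteDimensional ℝ G] :
    ∃ K : ℝ, 0 ≤ K ∧ ∀ (g : S3 → G) (f : S3 → F), ContMDiff (𝓡 3) 𝓘(ℝ, G) 1 g →
      ContMDiff (𝓡 3) 𝓘(ℝ, F) 1 f →
      ∫ x, ‖g x‖ ^ 2 * ‖f x‖ ^ 2 ∂dvol ≤ K * (normSqH1 g * normSqH1 f) := by
  obtain ⟨K₁, hK₁, h₁⟩ := exists_integral_norm_pow_four_le (F := G)
  obtain ⟨K₂, hK₂, h₂⟩ := exists_integral_norm_pow_four_le (F := F)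
  refine ⟨√K₁ * √K₂, by positivity, fun g f hg hf => ?_⟩
  have hm : ∀ {H : Type} [NormedAddCommGroup H] (u : S3 → H), Continuous u →
      MemLp (fun x => ‖u x‖ ^ 2) (ENNReal.ofReal 2) dvol := by
    intro H _ u hu
    exact (hu.norm.pow 2).memLp_of_hasCompactSupport (HasCompactSupport.of_compactSpace _)
  -- Cauchy–Schwarz leaves the product of the two squared `L⁴` norms.
  have h := integral_mul_le_Lp_mul_Lq_of_nonneg Real.HolderConjugate.two_two
    (μ := dvol) (f := fun x => ‖g x‖ ^ 2) (g := fun x => ‖f x‖ ^ 2)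
    (Filter.Eventually.of_forall fun x => by positivity)
    (Filter.Eventually.of_forall fun x => by positivity) (hm g hg.continuous) (hm f hf.continuous)
  refine h.trans ?_
  have e : ∀ r : ℝ, (r ^ 2) ^ (2 : ℝ) = r ^ 4 := fun r => by rw [Real.rpow_two, ← pow_mul]
  simp only [e, ← Real.sqrt_eq_rpow]
  calc √(∫ x, ‖g x‖ ^ 4 ∂dvol) * √(∫ x, ‖f x‖ ^ 4 ∂dvol)
      ≤ √(K₁ * normSqH1 g ^ 2) * √(K₂ * normSqH1 f ^ 2) := by
        gcongr
        · exact h₁ g hg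
        · exact h₂ f hf
    _ = _ := by
        rw [Real.sqrt_mul hK₁, Real.sqrt_mul hK₂, Real.sqrt_sq (normSqH1_nonneg g),
          Real.sqrt_sq (normSqH1_nonneg f)]
        ring

/-- Integrating the Gauss formula shows that the left side equals `2‖𝐀‖² + ‖∇̸𝐀‖²` in `L²` norms.
Writing the density of `∇̸𝐀` as a difference of continuous functions also settles its integrability.
-/
theorem normSqH1_sharp_le {A : OneForm} (hA : IsC1Form A) (τ : ℝ) :
    normSqH1 (sharp (spacePart A τ)) ≤ 2 * formNormSqH1 (spacePart A τ) := by
  have hs := contMDiff_sharp_spacePart hA τ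
  have h1 : ∀ x, covecNormSq x (covDeriv (spacePart A τ) x) =
      covecNormSq x (mvfderiv (𝓡 3) (sharp (spacePart A τ)) x) - ‖sharp (spacePart A τ) x‖ ^ 2 := fun x => by
    rw [covecNormSq_mvfderiv_sharp x ((hs x).mdifferentiableAt (by simp)), norm_sharp_sq]
    ring
  have h2 := integral_sub (continuous_covecNormSq_mvfderiv hs).integrable_dvol
    (hs.continuous.norm.pow 2).integrable_dvol
  have h3 : 0 ≤ ∫ x, covecNormSq x (covDeriv (spacePart A τ) x) ∂dvol :=
    integral_nonneg fun _ => covecNormSq_nonneg _ _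
  simp only [Pi.pow_apply, ← h1] at h2
  simp only [normSqH1, normSqL2, formNormSqH1, ← norm_sharp_sq]
  linarith

/-! ### Gauge covariant derivatives and energy densities on a slice -/

theorem gaugeD_dtau (A : OneForm) {ψ : Cyl → ℂ} (hψ : ContMDiff modelCyl 𝓘(ℝ, ℂ) 1 ψ) (τ : ℝ)
    (x : S3) : gaugeD A ψ (τ, x) (dtau (τ, x)) =
      deriv (fun s => ψ (s, x)) τ + Complex.I * (timePart A τ x : ℂ) * ψ (τ, x) := by
  have h1 : MDifferentiableAt 𝓘(ℝ, ℝ) modelCyl (fun s : ℝ => ((s, x) : Cyl)) τ :=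
    mdifferentiableAt_id.prodMk mdifferentiableAt_const
  have h := mfderiv_comp_apply τ ((hψ (τ, x)).mdifferentiableAt (by simp)) h1 (1 : ℝ)
  rw [mfderiv_prod_left, mfderiv_eq_fderiv] at h
  have h2 : mvfderiv modelCyl ψ (τ, x) (dtau (τ, x)) = deriv (fun s => ψ (s, x)) τ :=
    h.symm.trans (fderiv_apply_one_eq_deriv (𝕜 := ℝ) (f := fun s => ψ (s, x)) (x := τ))
  rw [gaugeD, h2]
  rfl

theorem gaugeD_spatial (A : OneForm) {ψ : Cyl → ℂ} (hψ : ContMDiff modelCyl 𝓘(ℝ, ℂ) 1 ψ) (τ : ℝ)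
    (x : S3) (u : TangentSpace (𝓡 3) x) : gaugeD A ψ (τ, x) (spatial (τ, x) u) =
      mvfderiv (𝓡 3) (fun x => ψ (τ, x)) x u +
        Complex.I * (spacePart A τ x u : ℂ) * ψ (τ, x) := by
  have h1 : MDifferentiableAt (𝓡 3) modelCyl (fun x : S3 => ((τ, x) : Cyl)) x :=
    mdifferentiableAt_const.prodMk mdifferentiableAt_id
  have h := mfderiv_comp_apply x ((hψ (τ, x)).mdifferentiableAt (by simp)) h1 u
  rw [mfderiv_prod_right] at h
  have h2 : mvfderiv modelCyl ψ (τ, x) (spatial (τ, x) u) =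
    mvfderiv (𝓡 3) (fun x => ψ (τ, x)) x u := h.symm
  rw [gaugeD, h2]
  rfl

theorem contMDiff_slice {ψ : Cyl → ℂ} (hψ : ContMDiff modelCyl 𝓘(ℝ, ℂ) 1 ψ) (τ : ℝ) :
    ContMDiff (𝓡 3) 𝓘(ℝ, ℂ) 1 (fun x => ψ (τ, x)) :=
  hψ.comp (contMDiff_const.prodMk contMDiff_id)

/-- `∂_τ ψ` is the derivative of the `C¹` function `ψ ∘ cylProj` in the fixed direction `(1, 0)` of
`ℝ × ℝ⁴`. -/
theorem continuous_deriv_slice {ψ : Cyl → ℂ} (hψ : ContMDiff modelCyl 𝓘(ℝ, ℂ) 1 ψ) (τ : ℝ) :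
    Continuous fun x => deriv (fun s => ψ (s, x)) τ := by
  have hc : ∀ x : S3, ContDiffAt ℝ 1 (ψ ∘ cylProj) (τ, (x : E4)) := fun x =>
    ((hψ _).comp (τ, (x : E4)) ((contMDiffAt_cylProj (p := (τ, (x : E4)))
      (ne_zero_of_mem_unit_sphere x)).of_le le_top)).contDiffAt
  have h : ∀ x : S3, deriv (fun s => ψ (s, x)) τ =
      fderiv ℝ (ψ ∘ cylProj) (τ, (x : E4)) (1, 0) := fun x => by
    have h1 := ((hc x).differentiableAt (by simp)).hasFDerivAt.comp_hasDerivAt τ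
      ((hasDerivAt_id τ).prodMk (hasDerivAt_const τ (x : E4)))
    rw [← h1.deriv]
    congr 1
    ext1 s
    simp [cylProj]
  simp_rw [h]
  refine continuous_iff_continuousAt.2 fun x => ?_
  have h1 := ((hc x).fderiv_right (m := 0) (by simp)).continuousAt
  exact (ContinuousAt.comp (f := fun x : S3 => (τ, (x : E4))) h1
    (by fun_prop)).clm_apply continuousAt_const

theorem norm_sq_le_of_gauge (z f : ℂ) (a : ℝ) :
    ‖z‖ ^ 2 ≤ 2 * ‖z + Complex.I * a * f‖ ^ 2 + 2 * (a ^ 2 * ‖f‖ ^ 2) := by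
  have h := norm_sub_le (z + Complex.I * a * f) (Complex.I * a * f)
  rw [add_sub_cancel_right] at h
  have h1 : ‖Complex.I * a * f‖ ^ 2 = a ^ 2 * ‖f‖ ^ 2 := by simp [mul_pow]
  rw [← h1]
  calc _ ≤ _ := pow_le_pow_left₀ (norm_nonneg _) h 2
    _ ≤ _ := add_sq_le
    _ = _ := by ring

theorem gauge_norm_sq_le (z f : ℂ) (a : ℝ) :
    ‖z + Complex.I * a * f‖ ^ 2 ≤ 2 * ‖z‖ ^ 2 + 2 * (a ^ 2 * ‖f‖ ^ 2) := by
  have h := norm_add_le z (Complex.I * a * f)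
  have h1 : ‖Complex.I * a * f‖ ^ 2 = a ^ 2 * ‖f‖ ^ 2 := by simp [mul_pow]
  rw [← h1]
  calc _ ≤ _ := pow_le_pow_left₀ (norm_nonneg _) h 2
    _ ≤ _ := add_sq_le
    _ = _ := by ring

/-- The density of `S₁[ψ]`. -/
def sobolevDensity (ψ : Cyl → ℂ) (τ : ℝ) (x : S3) : ℝ :=
  ‖deriv (fun s => ψ (s, x)) τ‖ ^ 2 + densityH1 (fun x => ψ (τ, x)) x

/-- The density `|A|² |ψ|²` of the difference between the gauge covariant and the ordinary energy. -/
def potentialDensity (A : OneForm) (ψ : Cyl → ℂ) (τ : ℝ) (x : S3) : ℝ :=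
  ‖timePart A τ x‖ ^ 2 * ‖ψ (τ, x)‖ ^ 2 + ‖sharp (spacePart A τ) x‖ ^ 2 * ‖ψ (τ, x)‖ ^ 2

/-- Removing the potential from each derivative costs a factor `2`, and the `½` in `T_00` doubles it
to `4`. -/
theorem sobolevDensity_le (A : OneForm) {ψ : Cyl → ℂ} (hψ : ContMDiff modelCyl 𝓘(ℝ, ℂ) 1 ψ) (τ : ℝ)
    (x : S3) : sobolevDensity ψ τ x ≤
    4 * stressEnergy A ψ (τ, x) (dtau (τ, x)) (dtau (τ, x)) + 2 * potentialDensity A ψ τ x := by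
  rw [stressEnergy_dtau, sobolevDensity, potentialDensity, norm_sharp_sq, densityH1, gaugeD_dtau A hψ]
  simp only [covecNormSq, gaugeD_spatial A hψ, Real.norm_eq_abs, sq_abs, Finset.sum_mul]
  have h1 := norm_sq_le_of_gauge (deriv (fun s => ψ (s, x)) τ) (ψ (τ, x)) (timePart A τ x)
  have h2 := Finset.sum_le_sum fun (j : Fin 4) (_ : j ∈ Finset.univ) =>
    norm_sq_le_of_gauge (mvfderiv (𝓡 3) (fun x => ψ (τ, x)) x (frame j x)) (ψ (τ, x))
      (spacePart A τ x (frame j x))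
  rw [Finset.sum_add_distrib, ← Finset.mul_sum, ← Finset.mul_sum] at h2
  linarith [sq_nonneg ‖ψ (τ, x)‖]

theorem stressEnergy_dtau_le (A : OneForm) {ψ : Cyl → ℂ} (hψ : ContMDiff modelCyl 𝓘(ℝ, ℂ) 1 ψ) (τ : ℝ)
    (x : S3) : stressEnergy A ψ (τ, x) (dtau (τ, x)) (dtau (τ, x)) ≤
    sobolevDensity ψ τ x + potentialDensity A ψ τ x := by
  rw [stressEnergy_dtau, sobolevDensity, potentialDensity, norm_sharp_sq, densityH1, gaugeD_dtau A hψ]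
  simp only [covecNormSq, gaugeD_spatial A hψ, Real.norm_eq_abs, sq_abs, Finset.sum_mul]
  have h1 := gauge_norm_sq_le (deriv (fun s => ψ (s, x)) τ) (ψ (τ, x)) (timePart A τ x)
  have h2 := Finset.sum_le_sum fun (j : Fin 4) (_ : j ∈ Finset.univ) =>
    gauge_norm_sq_le (mvfderiv (𝓡 3) (fun x => ψ (τ, x)) x (frame j x)) (ψ (τ, x))
      (spacePart A τ x (frame j x))
  rw [Finset.sum_add_distrib, ← Finset.mul_sum, ← Finset.mul_sum] at h2
  linarith [sq_nonneg ‖ψ (τ, x)‖]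

theorem continuous_sobolevDensity {ψ : Cyl → ℂ} (hψ : ContMDiff modelCyl 𝓘(ℝ, ℂ) 1 ψ) (τ : ℝ) :
    Continuous (sobolevDensity ψ τ) :=
  ((continuous_deriv_slice hψ τ).norm.pow 2).add (continuous_densityH1 (contMDiff_slice hψ τ))

theorem integral_sobolevDensity {ψ : Cyl → ℂ} (hψ : ContMDiff modelCyl 𝓘(ℝ, ℂ) 1 ψ) (τ : ℝ) :
    ∫ x, sobolevDensity ψ τ x ∂dvol = sobolevEnergy ψ τ := by
  rw [sobolevEnergy, ← integral_densityH1 (contMDiff_slice hψ τ)]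
  exact integral_add ((continuous_deriv_slice hψ τ).norm.pow 2).integrable_dvol
    (continuous_densityH1 (contMDiff_slice hψ τ)).integrable_dvol

theorem continuous_stressEnergy_dtau {A : OneForm} {ψ : Cyl → ℂ} (hψ : ContMDiff modelCyl 𝓘(ℝ, ℂ) 1 ψ) (τ : ℝ)
    (hA : IsC1Form A) :
    Continuous fun x => stressEnergy A ψ (τ, x) (dtau (τ, x)) (dtau (τ, x)) := by
  simp only [stressEnergy_dtau, covecNormSq, gaugeD_spatial A hψ, gaugeD_dtau A hψ]
  have h1 := (contMDiff_slice hψ τ).continuous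
  have h2 := continuous_deriv_slice hψ τ
  have h3 := (contMDiff_timePart hA τ).continuous
  have h4 := fun j => (contMDiff_spacePart_frame hA τ j).continuous
  have h5 := fun j => continuous_mvfderiv_frame (contMDiff_slice hψ τ) j
  have h6 : ∀ {z : S3 → ℂ} {a : S3 → ℝ}, Continuous z → Continuous a →
      Continuous fun x => ‖z x + Complex.I * a x * ψ (τ, x)‖ ^ 2 := fun hz ha =>
    (hz.add ((continuous_const.mul (Complex.continuous_ofReal.comp ha)).mul h1)).norm.pow 2
  exact ((continuous_const.mul (h6 h2 h3)).add (continuous_const.mul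
    (continuous_finsetSum _ fun j _ => h6 (h5 j) (h4 j)))).add
    (continuous_const.mul (h1.norm.pow 2))

theorem continuous_potentialDensity {A : OneForm} {ψ : Cyl → ℂ} (hψ : ContMDiff modelCyl 𝓘(ℝ, ℂ) 1 ψ) (τ : ℝ)
    (hA : IsC1Form A) : Continuous (potentialDensity A ψ τ) := by
  have h1 := (contMDiff_slice hψ τ).continuous
  have h2 := (contMDiff_timePart hA τ).continuous
  have h3 := (contMDiff_sharp_spacePart hA τ).continuous
  exact ((h2.norm.pow 2).mul (h1.norm.pow 2)).add ((h3.norm.pow 2).mul (h1.norm.pow 2))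

/-- `‖|A| |ψ|‖²_{L²} ≲ S₁[A] S₁[ψ]`. -/
theorem exists_integral_potentialDensity_le :
    ∃ K : ℝ, 0 ≤ K ∧ ∀ (τ : ℝ) (A : OneForm) (ψ : Cyl → ℂ), IsC1Form A →
      ContMDiff modelCyl 𝓘(ℝ, ℂ) 1 ψ →
      ∫ x, potentialDensity A ψ τ x ∂dvol ≤ K * (sobolevEnergyForm A τ * sobolevEnergy ψ τ) := by
  obtain ⟨K₁, hK₁, h₁⟩ := exists_integral_norm_sq_mul_norm_sq_le ℂ ℝ
  obtain ⟨K₂, hK₂, h₂⟩ := exists_integral_norm_sq_mul_norm_sq_le ℂ E4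
  -- The `2` is the loss in passing from `𝐀` to its dual field, `normSqH1_sharp_le`.
  refine ⟨K₁ + 2 * K₂, by positivity, fun τ A ψ hA hψ => ?_⟩
  have hf := contMDiff_slice hψ τ
  have ht := contMDiff_timePart hA τ
  have hs := contMDiff_sharp_spacePart hA τ
  have hi : ∫ x, potentialDensity A ψ τ x ∂dvol =
      (∫ x, ‖timePart A τ x‖ ^ 2 * ‖ψ (τ, x)‖ ^ 2 ∂dvol) +
        ∫ x, ‖sharp (spacePart A τ) x‖ ^ 2 * ‖ψ (τ, x)‖ ^ 2 ∂dvol :=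
    integral_add ((ht.continuous.norm.pow 2).mul (hf.continuous.norm.pow 2)).integrable_dvol
      ((hs.continuous.norm.pow 2).mul (hf.continuous.norm.pow 2)).integrable_dvol
  have hdot : 0 ≤ ∫ x, covecNormSq x (spacePartDot A τ x) ∂dvol :=
    integral_nonneg fun _ => covecNormSq_nonneg _ _
  have ht0 := normSqH1_nonneg (timePart A τ)
  have hs0 := normSqH1_nonneg (sharp (spacePart A τ))
  have hsle := normSqH1_sharp_le hA τ
  have hψle : normSqH1 (fun x => ψ (τ, x)) ≤ sobolevEnergy ψ τ :=
    le_add_of_nonneg_left (integral_nonneg fun _ => by positivity)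
  have hψ0 := normSqH1_nonneg (fun x => ψ (τ, x))
  have hA1 : normSqH1 (timePart A τ) ≤ sobolevEnergyForm A τ := by
    rw [sobolevEnergyForm]; linarith
  have hA2 : normSqH1 (sharp (spacePart A τ)) ≤ 2 * sobolevEnergyForm A τ := by
    rw [sobolevEnergyForm]; linarith
  have hA0 : 0 ≤ sobolevEnergyForm A τ := ht0.trans hA1
  rw [hi]
  calc _ ≤ K₁ * (normSqH1 (timePart A τ) * normSqH1 (fun x => ψ (τ, x))) +
        K₂ * (normSqH1 (sharp (spacePart A τ)) * normSqH1 (fun x => ψ (τ, x))) :=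
      add_le_add (h₁ _ _ ht hf) (h₂ _ _ hs hf)
    _ ≤ K₁ * (sobolevEnergyForm A τ * sobolevEnergy ψ τ) +
        K₂ * (2 * sobolevEnergyForm A τ * sobolevEnergy ψ τ) := by gcongr
    _ = _ := by ring

end EinsteinCylinder

end

/-! ### Absorption of the potential term -/

theorem mainTheorem6 :
    ∃ ε C : ℝ, 0 < ε ∧ 0 < C ∧
      ∀ (τ : ℝ) (A : EinsteinCylinder.OneForm) (ψ : EinsteinCylinder.Cyl → ℂ),
        EinsteinCylinder.IsC1Form A →
        ContMDiff EinsteinCylinder.modelCyl 𝓘(ℝ, ℂ) 1 ψ →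
        EinsteinCylinder.sobolevEnergyForm A τ ≤ ε →
          EinsteinCylinder.sobolevEnergy ψ τ ≤ C * EinsteinCylinder.geometricEnergy A ψ τ ∧
          EinsteinCylinder.geometricEnergy A ψ τ ≤ C * EinsteinCylinder.sobolevEnergy ψ τ := by
  open EinsteinCylinder MeasureTheory in
  obtain ⟨K, hK, h⟩ := exists_integral_potentialDensity_le
  -- With `Kε ≤ 1/4` (`K + 1` keeps the denominator positive), the potential term `P` is at most
  -- `S/4`, where `S` is the Sobolev energy and `E` the geometric one. Then `S ≤ 4E + 2P ≤ 4E + S/2`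
  -- yields `S ≤ 8E`, while `E ≤ S + P ≤ 5S/4`.
  refine ⟨1 / (4 * (K + 1)), 8, by positivity, by norm_num, fun τ A ψ hA hψ hε => ?_⟩
  have hS : 0 ≤ sobolevEnergy ψ τ :=
    add_nonneg (integral_nonneg fun _ => by positivity) (normSqH1_nonneg _)
  have iD := (continuous_sobolevDensity hψ τ).integrable_dvol
  have iE := (continuous_stressEnergy_dtau hψ τ hA).integrable_dvol
  have iP := (continuous_potentialDensity hψ τ hA).integrable_dvol
  have h1 := integral_mono iD ((iE.const_mul 4).add (iP.const_mul 2)) (sobolevDensity_le A hψ τ)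
  have h2 := integral_mono iE (iD.add iP) (stressEnergy_dtau_le A hψ τ)
  simp only [Pi.add_apply] at h1 h2
  rw [integral_add (iE.const_mul 4) (iP.const_mul 2), integral_const_mul, integral_const_mul,
    integral_sobolevDensity hψ] at h1
  rw [integral_add iD iP, integral_sobolevDensity hψ] at h2
  have h3 : ∫ x, potentialDensity A ψ τ x ∂dvol ≤ 1 / 4 * sobolevEnergy ψ τ := by
    refine (h τ A ψ hA hψ).trans ?_
    rw [← mul_assoc]
    refine mul_le_mul_of_nonneg_right ?_ hS
    calc K * sobolevEnergyForm A τ ≤ K * (1 / (4 * (K + 1))) := by gcongr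
      _ ≤ 1 / 4 := by
        rw [mul_one_div, div_le_div_iff₀ (by positivity) (by norm_num)]
        linarith
  change _ ≤ 4 * geometricEnergy A ψ τ + _ at h1
  change geometricEnergy A ψ τ ≤ _ at h2
  constructor <;> linarith
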